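/- Let $N\in\mathbb N$, let $\Omega\subset\mathbb R^N$ be a non-empty open set, and for $p\in(1,\infty)$ let $W^{1,p}(\Omega)$ be the Sobolev space of all real-valued $u\in L^p(\Omega)$ whose distributional first partial derivatives lie in $L^p(\Omega)$, with $$\|u\|^p_{W^{1,p}(\Omega)}=\|u\|^p_{L^p(\Omega)}+\sum_{i=1}^N\|\partial_i u\|^p_{L^p(\Omega)}.$$ Let $\tilde W^{1,p}(\Omega)$ be the closure in $W^{1,p}(\Omega)$ of the set of those functions in $W^{1,p}(\Omega)$ that are restrictions to $\Omega$ of continuous functions with compact support on $\overline\Omega$. For $A\subset\overline\Omega$ define the relative $p$-capacity $$\operatorname{Cap}_{p,\Omega}(A)=\inf\bigl\{\|u\|^p_{W^{1,p}(\Omega)} : u\in\tilde W^{1,p}(\Omega),\ \exists\, O \text{ open in }\overline\Omega \text{ with } A\subset O \text{ and } u\ge 1 \text{ a.e. on } O\cap\Omega\bigr\}\in[0,\infty],$$ with $\inf\emptyset=\infty$. Let $1<q\le p<\infty$ and let $A\subset\overline\Omega$ satisfy $\operatorname{Cap}_{p,\Omega}(A)=0$. Then $\operatorname{Cap}_{q,\Omega}(A)=0$.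 -/

import Mathlib

open MeasureTheory Set
open scoped ENNReal ContDiff

noncomputable section

namespace RelativeCapacity

variable {N : ℕ}

/-- `g` is the weak (distributional) partial derivative `∂u/∂xᵢ` of `u` on the open set `Ω`, where
both functions are locally integrable on `Ω`: one has `∫_Ω u ∂ᵢφ = -∫_Ω g φ` for all test
functions `φ ∈ 𝒟(Ω)`. -/
def HasWeakPartial (Ω : Set (EuclideanSpace ℝ (Fin N))) (i : Fin N)
    (u g : EuclideanSpace ℝ (Fin N) → ℝ) : Prop :=
  LocallyIntegrableOn u Ω ∧ LocallyIntegrableOn g Ω ∧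
    ∀ φ : EuclideanSpace ℝ (Fin N) → ℝ,
      ContDiff ℝ ∞ φ → HasCompactSupport φ → tsupport φ ⊆ Ω →
        ∫ x in Ω, u x * fderiv ℝ φ x (EuclideanSpace.single i 1) = -∫ x in Ω, g x * φ x

open Classical in
/-- The weak partial derivative of `u` in direction `i` on `Ω` (a chosen representative; it is
unique almost everywhere on `Ω`), and `0` if there is none. -/
def weakPartial (Ω : Set (EuclideanSpace ℝ (Fin N))) (i : Fin N)
    (u : EuclideanSpace ℝ (Fin N) → ℝ) : EuclideanSpace ℝ (Fin N) → ℝ :=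
  if h : ∃ g, HasWeakPartial Ω i u g then h.choose else 0

/-- `u` represents an element of the Sobolev space `W^{1,p}(Ω)`. Only the values of `u` on `Ω`
matter. -/
def MemW (Ω : Set (EuclideanSpace ℝ (Fin N))) (p : ℝ)
    (u : EuclideanSpace ℝ (Fin N) → ℝ) : Prop :=
  MemLp u (ENNReal.ofReal p) (volume.restrict Ω) ∧
    ∀ i : Fin N, ∃ g : EuclideanSpace ℝ (Fin N) → ℝ,
      HasWeakPartial Ω i u g ∧ MemLp g (ENNReal.ofReal p) (volume.restrict Ω)

/-- The `p`-th power of the Sobolev norm,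
`‖u‖^p_{W^{1,p}(Ω)} = ‖u‖^p_{L^p(Ω)} + ∑ᵢ ‖∂ᵢu‖^p_{L^p(Ω)}`. -/
def sobolevNormPow (Ω : Set (EuclideanSpace ℝ (Fin N))) (p : ℝ)
    (u : EuclideanSpace ℝ (Fin N) → ℝ) : ℝ≥0∞ :=
  eLpNorm u (ENNReal.ofReal p) (volume.restrict Ω) ^ p +
    ∑ i : Fin N, eLpNorm (weakPartial Ω i u) (ENNReal.ofReal p) (volume.restrict Ω) ^ p

/-- `v` restricts to an element of `C_c(Ω̄)`: its restriction to `Ω̄` is continuous and has compact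
support in the space `Ω̄`. -/
def MemCc (Ω : Set (EuclideanSpace ℝ (Fin N))) (v : EuclideanSpace ℝ (Fin N) → ℝ) : Prop :=
  Continuous ((closure Ω).domRestrict v) ∧ HasCompactSupport ((closure Ω).domRestrict v)

/-- `u` represents an element of `W̃^{1,p}(Ω)`, the closure of `W^{1,p}(Ω) ∩ C_c(Ω̄)` in
`W^{1,p}(Ω)`. -/
def MemWTilde (Ω : Set (EuclideanSpace ℝ (Fin N))) (p : ℝ)
    (u : EuclideanSpace ℝ (Fin N) → ℝ) : Prop :=
  MemW Ω p u ∧ ∀ ε : ℝ≥0∞, 0 < ε →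
    ∃ v : EuclideanSpace ℝ (Fin N) → ℝ,
      MemW Ω p v ∧ MemCc Ω v ∧ sobolevNormPow Ω p (u - v) < ε

/-- `O` is an open subset of the topological space `Ω̄`. -/
def IsRelOpen (Ω O : Set (EuclideanSpace ℝ (Fin N))) : Prop :=
  ∃ U : Set (EuclideanSpace ℝ (Fin N)), IsOpen U ∧ O = U ∩ closure Ω

/-- The admissible class `𝒴_{p,Ω}(A)`: all `u ∈ W̃^{1,p}(Ω)` for which there is a set `O`, open in
`Ω̄`, with `A ⊆ O` and `u ≥ 1` almost everywhere on `O ∩ Ω`. -/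
def admissible (Ω : Set (EuclideanSpace ℝ (Fin N))) (p : ℝ)
    (A : Set (EuclideanSpace ℝ (Fin N))) : Set (EuclideanSpace ℝ (Fin N) → ℝ) :=
  {u | MemWTilde Ω p u ∧ ∃ O : Set (EuclideanSpace ℝ (Fin N)),
    IsRelOpen Ω O ∧ A ⊆ O ∧ ∀ᵐ x ∂(volume.restrict (O ∩ Ω)), 1 ≤ u x}

/-- The relative `p`-capacity `Cap_{p,Ω}(A) ∈ [0,∞]`, equal to `∞` if no function is admissible. -/
def relCap (Ω : Set (EuclideanSpace ℝ (Fin N))) (p : ℝ)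
    (A : Set (EuclideanSpace ℝ (Fin N))) : ℝ≥0∞ :=
  ⨅ u ∈ admissible Ω p A, sobolevNormPow Ω p u

end RelativeCapacity

end

open Filter Topology Metric

namespace RelativeCapacity

variable {N : ℕ} {Ω : Set (EuclideanSpace ℝ (Fin N))}

/-! ### Calculus of weak partial derivatives -/

/-! On a set of finite measure Hölder bounds the `L^q` norm by the `L^p` norm, but `Ω` may have
infinite measure. Hence a partition of unity `η n` by test functions, with `η n = 0` on `ball 0 n`:
multiplication by `η n` maps `W^{1,p}` to `W^{1,q}` with some constant `C n`
(`exists_hasSobolevBound_mul`). Vanishing `p`-capacity supplies admissible `u n` so small that the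
`W^{1,q}` bounds of `η n * u n` have an arbitrarily small sum, and `u = ∑ η n * u n` is the
candidate for exponent `q`. The sum is locally finite, so it is differentiated termwise
(`HasSobolevBound.tsum`). In `ball 0 R` only the terms `n < R` survive, so `u ≥ ∑ η n = 1` wherever
those finitely many `u n` are at least 1, which holds a.e. on a relative neighbourhood of `A`.
Replacing finitely many `u n` by functions in `C_c(Ω̄)` and dropping the tail shows `u ∈ W̃^{1,q}`
(`memWTilde_tsum_mul`). -/

lemma integrable_mul_of_hasCompactSupport {u ψ : EuclideanSpace ℝ (Fin N) → ℝ}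
    (hu : LocallyIntegrableOn u Ω) (hψ : Continuous ψ) (hc : HasCompactSupport ψ)
    (hs : tsupport ψ ⊆ Ω) : Integrable (fun x => u x * ψ x) (volume.restrict Ω) := by
  have h1 : IntegrableOn (fun x => u x * ψ x) (tsupport ψ) :=
    (hu.integrableOn_compact_subset hs hc).mul_continuousOn hψ.continuousOn hc
  refine ((integrableOn_iff_integrable_of_support_subset ?_).1 h1).integrableOn
  intro x hx
  exact subset_tsupport ψ (right_ne_zero_of_mul hx)

lemma continuous_partial {φ : EuclideanSpace ℝ (Fin N) → ℝ} (hφ : ContDiff ℝ ∞ φ)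
    (v : EuclideanSpace ℝ (Fin N)) : Continuous fun x => fderiv ℝ φ x v :=
  (hφ.continuous_fderiv (by simp)).clm_apply continuous_const

lemma hasCompactSupport_partial {φ : EuclideanSpace ℝ (Fin N) → ℝ} (hφ : HasCompactSupport φ)
    (v : EuclideanSpace ℝ (Fin N)) : HasCompactSupport fun x => fderiv ℝ φ x v :=
  hφ.fderiv_apply ℝ v

lemma tsupport_partial_subset (φ : EuclideanSpace ℝ (Fin N) → ℝ)
    (v : EuclideanSpace ℝ (Fin N)) : tsupport (fun x => fderiv ℝ φ x v) ⊆ tsupport φ :=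
  tsupport_fderiv_apply_subset ℝ v

lemma HasWeakPartial.sub {i : Fin N} {u g v h : EuclideanSpace ℝ (Fin N) → ℝ}
    (hu : HasWeakPartial Ω i u g) (hv : HasWeakPartial Ω i v h) :
    HasWeakPartial Ω i (u - v) (g - h) := by
  refine ⟨hu.1.sub hv.1, hu.2.1.sub hv.2.1, fun φ hφ hc hs => ?_⟩
  have hs' := (tsupport_partial_subset φ (EuclideanSpace.single i 1)).trans hs
  have hc' := hasCompactSupport_partial hc (EuclideanSpace.single i 1)
  have hφ' := continuous_partial hφ (EuclideanSpace.single i 1)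
  simp only [Pi.sub_apply, sub_mul]
  rw [integral_sub (integrable_mul_of_hasCompactSupport hu.1 hφ' hc' hs')
      (integrable_mul_of_hasCompactSupport hv.1 hφ' hc' hs'),
    integral_sub (integrable_mul_of_hasCompactSupport hu.2.1 hφ.continuous hc hs)
      (integrable_mul_of_hasCompactSupport hv.2.1 hφ.continuous hc hs),
    hu.2.2 φ hφ hc hs, hv.2.2 φ hφ hc hs]
  ring

lemma hasWeakPartial_zero (i : Fin N) : HasWeakPartial Ω i 0 0 :=
  ⟨locallyIntegrableOn_zero, locallyIntegrableOn_zero, fun φ _ _ _ => by simp⟩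

lemma HasWeakPartial.add {i : Fin N} {u g v h : EuclideanSpace ℝ (Fin N) → ℝ}
    (hu : HasWeakPartial Ω i u g) (hv : HasWeakPartial Ω i v h) :
    HasWeakPartial Ω i (u + v) (g + h) := by
  simpa using hu.sub ((hasWeakPartial_zero i).sub hv)

lemma HasWeakPartial.sum {i : Fin N} {u g : ℕ → EuclideanSpace ℝ (Fin N) → ℝ}
    (s : Finset ℕ) (h : ∀ n, HasWeakPartial Ω i (u n) (g n)) :
    HasWeakPartial Ω i (∑ n ∈ s, u n) (∑ n ∈ s, g n) := by
  classical
  induction s using Finset.induction_on with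
  | empty => simpa using hasWeakPartial_zero i
  | insert a s ha ih => simpa [Finset.sum_insert ha] using (h a).add ih

/-- The weak Leibniz rule for the product with a smooth function. -/
lemma HasWeakPartial.mul_contDiff {i : Fin N} {u g η : EuclideanSpace ℝ (Fin N) → ℝ}
    (hΩ : IsOpen Ω) (hu : HasWeakPartial Ω i u g) (hη : ContDiff ℝ ∞ η) :
    HasWeakPartial Ω i (η * u)
      (η * g + (fun x => fderiv ℝ η x (EuclideanSpace.single i 1)) * u) := by
  have hη' := continuous_partial hη (EuclideanSpace.single i 1)
  refine ⟨hu.1.continuousOn_mul hη.continuous.continuousOn hΩ.isLocallyClosed,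
    (hu.2.1.continuousOn_mul hη.continuous.continuousOn hΩ.isLocallyClosed).add
      (hu.1.continuousOn_mul hη'.continuousOn hΩ.isLocallyClosed), fun φ hφ hc hs => ?_⟩
  -- `η * φ` is again a test function; the classical product rule then moves the derivative of `η`
  -- to the other side.
  have hprod := hu.2.2 (η * φ) (hη.mul hφ) hc.mul_left ((tsupport_mul_subset_right).trans hs)
  have hd : ∀ x, fderiv ℝ (η * φ) x (EuclideanSpace.single i 1) =
      η x * fderiv ℝ φ x (EuclideanSpace.single i 1) +
        fderiv ℝ η x (EuclideanSpace.single i 1) * φ x := by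
    intro x
    rw [fderiv_mul (hη.differentiable (by simp) x) (hφ.differentiable (by simp) x)]
    simp [mul_comm]
  have hs' := (tsupport_partial_subset φ (EuclideanSpace.single i 1)).trans hs
  have hc' := hasCompactSupport_partial hc (EuclideanSpace.single i 1)
  have hφ' := continuous_partial hφ (EuclideanSpace.single i 1)
  have i1 := integrable_mul_of_hasCompactSupport (ψ := η * fun x =>
    fderiv ℝ φ x (EuclideanSpace.single i 1)) hu.1 (hη.continuous.mul hφ') hc'.mul_left
    (tsupport_mul_subset_right.trans hs')
  have i2 := integrable_mul_of_hasCompactSupport (ψ := (fun x =>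
    fderiv ℝ η x (EuclideanSpace.single i 1)) * φ) hu.1 (hη'.mul hφ.continuous) hc.mul_left
    (tsupport_mul_subset_right.trans hs)
  have i3 := integrable_mul_of_hasCompactSupport (ψ := η * φ) hu.2.1
    (hη.continuous.mul hφ.continuous) hc.mul_left (tsupport_mul_subset_right.trans hs)
  simp only [hd, mul_add] at hprod
  simp only [Pi.mul_apply] at i1 i2 i3 hprod
  rw [integral_add i1 i2] at hprod
  have e1 : ∫ x in Ω, (η * u) x * fderiv ℝ φ x (EuclideanSpace.single i 1) =
      ∫ x in Ω, u x * (η x * fderiv ℝ φ x (EuclideanSpace.single i 1)) := by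
    congr 1; ext x; simp only [Pi.mul_apply]; ring
  have e2 : ∫ x in Ω, (η * g + (fun x => fderiv ℝ η x (EuclideanSpace.single i 1)) * u) x * φ x =
      (∫ x in Ω, g x * (η x * φ x)) +
        ∫ x in Ω, u x * (fderiv ℝ η x (EuclideanSpace.single i 1) * φ x) := by
    rw [← integral_add i3 i2]
    congr 1; ext x; simp only [Pi.mul_apply, Pi.add_apply]; ring
  rw [e1, e2]
  linarith

/-- Weak differentiability is a local property. -/
lemma hasWeakPartial_of_eqOn_ball {i : Fin N} {u g : EuclideanSpace ℝ (Fin N) → ℝ}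
    (h : ∀ R : ℕ, ∃ w k, HasWeakPartial Ω i w k ∧ EqOn u w (ball 0 R) ∧ EqOn g k (ball 0 R)) :
    HasWeakPartial Ω i u g := by
  have key : ∀ {a b : EuclideanSpace ℝ (Fin N) → ℝ} {x} {R : ℕ}, x ∈ ball 0 (R : ℝ) →
      EqOn a b (ball 0 R) → IntegrableAtFilter b (𝓝[Ω] x) → IntegrableAtFilter a (𝓝[Ω] x) := by
    rintro a b x R hx hab ⟨s, hs, hi⟩
    refine ⟨s ∩ ball 0 R, inter_mem hs (nhdsWithin_le_nhds (isOpen_ball.mem_nhds hx)), ?_⟩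
    have h1 : IntegrableOn b (s ∩ ball 0 R) := hi.mono_set inter_subset_left
    refine Integrable.congr h1 ?_
    have h2 : ∀ᵐ y ∂(volume.restrict (ball (0 : EuclideanSpace ℝ (Fin N)) R)), b y = a y :=
      ae_restrict_of_forall_mem measurableSet_ball fun y hy => (hab hy).symm
    exact ae_restrict_of_ae_restrict_of_subset inter_subset_right h2
  have hball : ∀ x : EuclideanSpace ℝ (Fin N), ∃ R : ℕ, x ∈ ball (0 : _) (R : ℝ) := fun x => by
    obtain ⟨R, hR⟩ := exists_nat_gt ‖x‖
    exact ⟨R, by simpa using hR⟩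
  refine ⟨fun x hx => ?_, fun x hx => ?_, fun φ hφ hc hs => ?_⟩
  · obtain ⟨R, hR⟩ := hball x
    obtain ⟨w, k, hw, hu, -⟩ := h R
    exact key hR hu (hw.1 x hx)
  · obtain ⟨R, hR⟩ := hball x
    obtain ⟨w, k, hw, -, hg⟩ := h R
    exact key hR hg (hw.2.1 x hx)
  · obtain ⟨r, hr⟩ := hc.isCompact.isBounded.subset_ball (0 : EuclideanSpace ℝ (Fin N))
    obtain ⟨R, hR⟩ := exists_nat_gt r
    replace hr := hr.trans (ball_subset_ball hR.le)
    obtain ⟨w, k, hw, hu, hg⟩ := h R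
    have e1 : ∀ x, u x * fderiv ℝ φ x (EuclideanSpace.single i 1) =
        w x * fderiv ℝ φ x (EuclideanSpace.single i 1) := fun x => by
      by_cases hx : x ∈ tsupport φ
      · rw [hu (hr hx)]
      · rw [image_eq_zero_of_notMem_tsupport fun h' => hx (tsupport_partial_subset φ _ h')]
        simp
    have e2 : ∀ x, g x * φ x = k x * φ x := fun x => by
      by_cases hx : x ∈ tsupport φ
      · rw [hg (hr hx)]
      · simp [image_eq_zero_of_notMem_tsupport hx]
    simp only [e1, e2]
    exact hw.2.2 φ hφ hc hs

/-- The difference is a weak derivative of 0, hence orthogonal to all test functions. -/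
lemma HasWeakPartial.ae_eq {i : Fin N} {u g h : EuclideanSpace ℝ (Fin N) → ℝ}
    (hΩ : IsOpen Ω) (hg : HasWeakPartial Ω i u g) (hh : HasWeakPartial Ω i u h) :
    g =ᵐ[volume.restrict Ω] h := by
  have := hg.sub hh
  have h0 := hΩ.ae_eq_zero_of_integral_contDiff_smul_eq_zero this.2.1 fun φ hφ hc hs => by
    have h1 := this.2.2 φ hφ hc hs
    simp only [sub_self, Pi.zero_apply, zero_mul, integral_zero] at h1
    rw [← setIntegral_eq_integral_of_forall_compl_eq_zero (s := Ω)]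
    · simp only [smul_eq_mul, mul_comm (φ _)]
      linarith
    · intro x hx
      simp [image_eq_zero_of_notMem_tsupport fun h' => hx (hs h')]
  rw [EventuallyEq, ae_restrict_iff' hΩ.measurableSet]
  filter_upwards [h0] with x hx hxΩ
  simpa [sub_eq_zero] using hx hxΩ

/-- Frees the Sobolev norm from the chosen representative: it can be computed with any weak
derivative at hand. -/
lemma HasWeakPartial.weakPartial_ae_eq {i : Fin N} {u g : EuclideanSpace ℝ (Fin N) → ℝ}
    (hΩ : IsOpen Ω) (hg : HasWeakPartial Ω i u g) :
    weakPartial Ω i u =ᵐ[volume.restrict Ω] g := by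
  have hex : ∃ g, HasWeakPartial Ω i u g := ⟨g, hg⟩
  rw [weakPartial, dif_pos hex]
  exact hex.choose_spec.ae_eq hΩ hg

/-! ### Sobolev bounds -/

/-- `u` has weak partial derivatives `G i` on `Ω`, and `u` and all the `G i` have `L^p(Ω)`-norm at
most `δ`. -/
structure HasSobolevBound (Ω : Set (EuclideanSpace ℝ (Fin N))) (p : ℝ)
    (u : EuclideanSpace ℝ (Fin N) → ℝ) (G : Fin N → EuclideanSpace ℝ (Fin N) → ℝ)
    (δ : ℝ≥0∞) : Prop where
  aestronglyMeasurable : AEStronglyMeasurable u (volume.restrict Ω)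
  hasWeakPartial : ∀ i, HasWeakPartial Ω i u (G i)
  eLpNorm_le : eLpNorm u (ENNReal.ofReal p) (volume.restrict Ω) ≤ δ
  eLpNorm_partial_le : ∀ i, eLpNorm (G i) (ENNReal.ofReal p) (volume.restrict Ω) ≤ δ

lemma HasWeakPartial.aestronglyMeasurable {i : Fin N} {u g : EuclideanSpace ℝ (Fin N) → ℝ}
    (h : HasWeakPartial Ω i u g) : AEStronglyMeasurable g (volume.restrict Ω) :=
  h.2.1.aestronglyMeasurable

namespace HasSobolevBound

variable {p : ℝ} {u : EuclideanSpace ℝ (Fin N) → ℝ}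
  {G : Fin N → EuclideanSpace ℝ (Fin N) → ℝ} {δ : ℝ≥0∞}

lemma mono {δ' : ℝ≥0∞} (h : HasSobolevBound Ω p u G δ) (hδ : δ ≤ δ') :
    HasSobolevBound Ω p u G δ' :=
  ⟨h.1, h.2, h.3.trans hδ, fun i => (h.4 i).trans hδ⟩

lemma memW (h : HasSobolevBound Ω p u G δ) (hδ : δ ≠ ⊤) : MemW Ω p u :=
  ⟨⟨h.1, h.3.trans_lt hδ.lt_top⟩, fun i => ⟨G i, h.2 i, (h.2 i).aestronglyMeasurable,
    (h.4 i).trans_lt hδ.lt_top⟩⟩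

lemma sobolevNormPow_le (hΩ : IsOpen Ω) (hp : 0 ≤ p) (h : HasSobolevBound Ω p u G δ) :
    sobolevNormPow Ω p u ≤ (N + 1) * δ ^ p := by
  have h1 : ∀ i, eLpNorm (weakPartial Ω i u) (ENNReal.ofReal p) (volume.restrict Ω) ^ p ≤ δ ^ p :=
    fun i => by
      rw [eLpNorm_congr_ae ((h.2 i).weakPartial_ae_eq hΩ)]
      exact ENNReal.rpow_le_rpow (h.4 i) hp
  calc sobolevNormPow Ω p u ≤ δ ^ p + ∑ _i : Fin N, δ ^ p :=
        add_le_add (ENNReal.rpow_le_rpow h.3 hp) (Finset.sum_le_sum fun i _ => h1 i)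
    _ = (N + 1) * δ ^ p := by simp; ring

/-- A locally finite sum inherits the sum of the Sobolev bounds. -/
lemma tsum {u : ℕ → EuclideanSpace ℝ (Fin N) → ℝ}
    {G : ℕ → Fin N → EuclideanSpace ℝ (Fin N) → ℝ} {δ : ℕ → ℝ≥0∞} (hp : 1 ≤ p)
    (h : ∀ n, HasSobolevBound Ω p (u n) (G n) (δ n))
    (hu : ∀ n, EqOn (u n) 0 (ball 0 n)) (hG : ∀ n i, EqOn (G n i) 0 (ball 0 n)) :
    HasSobolevBound Ω p (fun x => ∑' n, u n x) (fun i x => ∑' n, G n i x) (∑' n, δ n) := by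
  have hfin : ∀ f : ℕ → EuclideanSpace ℝ (Fin N) → ℝ, (∀ n, EqOn (f n) 0 (ball 0 n)) →
      ∀ R : ℕ, EqOn (fun x => ∑' n, f n x) (∑ n ∈ Finset.range R, f n) (ball 0 R) := by
    intro f hf R x hx
    rw [Finset.sum_apply]
    refine tsum_eq_sum fun n hn => hf n (ball_subset_ball ?_ hx)
    exact_mod_cast not_lt.1 (by simpa using hn)
  have hlim : ∀ f : ℕ → EuclideanSpace ℝ (Fin N) → ℝ, (∀ n, EqOn (f n) 0 (ball 0 n)) →
      ∀ x, Tendsto (fun R => (∑ n ∈ Finset.range R, f n) x) atTop (𝓝 (∑' n, f n x)) := by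
    intro f hf x
    obtain ⟨R₀, hR₀⟩ := exists_nat_gt ‖x‖
    refine tendsto_const_nhds.congr' ?_
    filter_upwards [eventually_ge_atTop R₀] with R hR
    refine hfin f hf R ?_
    have : (R₀ : ℝ) ≤ R := by exact_mod_cast hR
    simpa using hR₀.trans_le this
  have hnorm : ∀ f : ℕ → EuclideanSpace ℝ (Fin N) → ℝ, (∀ n, EqOn (f n) 0 (ball 0 n)) →
      (∀ n, AEStronglyMeasurable (f n) (volume.restrict Ω)) →
      (∀ n, eLpNorm (f n) (ENNReal.ofReal p) (volume.restrict Ω) ≤ δ n) →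
      eLpNorm (fun x => ∑' n, f n x) (ENNReal.ofReal p) (volume.restrict Ω) ≤ ∑' n, δ n := by
    intro f hf hm hle
    -- Fatou, then Minkowski for the partial sums.
    refine (Lp.eLpNorm_lim_le_liminf_eLpNorm
      (fun R => Finset.aestronglyMeasurable_sum (Finset.range R) fun n _ => hm n) _
      (ae_of_all _ (hlim f hf))).trans ?_
    refine liminf_le_of_le (by isBoundedDefault) fun b hb => ?_
    obtain ⟨R, hR⟩ := hb.exists
    refine hR.trans ((eLpNorm_sum_le (fun n _ => hm n) (by simpa using hp)).trans ?_)
    exact (Finset.sum_le_sum fun n _ => hle n).trans (ENNReal.sum_le_tsum _)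
  refine ⟨?_, fun i => ?_, hnorm _ hu (fun n => (h n).1) fun n => (h n).3, fun i =>
    hnorm (fun n => G n i) (fun n => hG n i) (fun n => ((h n).2 i).aestronglyMeasurable)
      fun n => (h n).4 i⟩
  · exact aestronglyMeasurable_of_tendsto_ae atTop
      (fun R => Finset.aestronglyMeasurable_sum (Finset.range R) fun n _ => (h n).1)
      (ae_of_all _ (hlim u hu))
  · exact hasWeakPartial_of_eqOn_ball fun R => ⟨_, _,
      HasWeakPartial.sum (Finset.range R) fun n => (h n).2 i, hfin u hu R,
      hfin (fun n => G n i) (fun n => hG n i) R⟩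

end HasSobolevBound

/-! ### Multiplication by test functions -/

/-- The partial derivatives of `η u`, expressed by those of `u`. -/
noncomputable def mulPartial (η u : EuclideanSpace ℝ (Fin N) → ℝ)
    (G : Fin N → EuclideanSpace ℝ (Fin N) → ℝ) (i : Fin N) : EuclideanSpace ℝ (Fin N) → ℝ :=
  η * G i + (fun x => fderiv ℝ η x (EuclideanSpace.single i 1)) * u

/-- Hölder with `1/r = 1/q - 1/p`, where `r = ∞` if `q = p`; a continuous compactly supported `a`
lies in every `L^r`. -/
lemma exists_eLpNorm_mul_le {p q : ℝ≥0∞} (hqp : q ≤ p)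
    {a : EuclideanSpace ℝ (Fin N) → ℝ} (ha : Continuous a) (hc : HasCompactSupport a)
    (Ω : Set (EuclideanSpace ℝ (Fin N))) :
    ∃ C : ℝ≥0∞, C ≠ ⊤ ∧ ∀ f : EuclideanSpace ℝ (Fin N) → ℝ,
      AEStronglyMeasurable f (volume.restrict Ω) →
      eLpNorm (a * f) q (volume.restrict Ω) ≤ C * eLpNorm f p (volume.restrict Ω) := by
  have : ENNReal.HolderTriple (q⁻¹ - p⁻¹)⁻¹ p q :=
    ⟨by rw [inv_inv, tsub_add_cancel_of_le (ENNReal.inv_le_inv.2 hqp)]⟩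
  exact ⟨eLpNorm a (q⁻¹ - p⁻¹)⁻¹ (volume.restrict Ω),
    (ha.memLp_of_hasCompactSupport hc).eLpNorm_ne_top,
    fun f hf => by
      simpa only [smul_eq_mul] using
        eLpNorm_smul_le_mul_eLpNorm (r := q) hf ha.aestronglyMeasurable⟩

/-- Multiplication with a test function is bounded from `W^{1,p}` to `W^{1,q}` for `q ≤ p`. -/
lemma exists_hasSobolevBound_mul (hΩ : IsOpen Ω) {p q : ℝ} (hq : 1 ≤ q) (hqp : q ≤ p)
    {η : EuclideanSpace ℝ (Fin N) → ℝ} (hη : ContDiff ℝ ∞ η) (hc : HasCompactSupport η) :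
    ∃ C : ℝ≥0∞, C ≠ ⊤ ∧ ∀ u G δ, HasSobolevBound Ω p u G δ →
      HasSobolevBound Ω q (η * u) (mulPartial η u G) (C * δ) := by
  have hqp' := ENNReal.ofReal_le_ofReal hqp
  obtain ⟨C₀, hC₀, h₀⟩ := exists_eLpNorm_mul_le hqp' hη.continuous hc Ω
  choose C hC h using fun i : Fin N => exists_eLpNorm_mul_le hqp'
    (continuous_partial hη (EuclideanSpace.single i 1))
    (hasCompactSupport_partial hc (EuclideanSpace.single i 1)) Ω
  refine ⟨C₀ + ∑ i, C i, by simp [hC₀, hC], fun u G δ hu => ?_⟩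
  have hm : ∀ i, AEStronglyMeasurable (fun x => fderiv ℝ η x (EuclideanSpace.single i 1))
      (volume.restrict Ω) := fun i =>
    (continuous_partial hη (EuclideanSpace.single i 1)).aestronglyMeasurable
  refine ⟨hη.continuous.aestronglyMeasurable.mul hu.1, fun i => (hu.2 i).mul_contDiff hΩ hη,
    (h₀ u hu.1).trans (mul_le_mul' le_self_add hu.3), fun i => ?_⟩
  have hGi := (hu.2 i).aestronglyMeasurable
  refine (eLpNorm_add_le (hη.continuous.aestronglyMeasurable.mul hGi) ((hm i).mul hu.1)
    (by simpa using hq)).trans ?_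
  rw [add_mul]
  exact add_le_add ((h₀ _ hGi).trans (mul_le_mul' le_rfl (hu.4 i)))
    ((h i u hu.1).trans (mul_le_mul' (Finset.single_le_sum (f := C) (fun _ _ => zero_le)
      (Finset.mem_univ i)) hu.3))

lemma HasWeakPartial.eLpNorm_le_rpow_sobolevNormPow (hΩ : IsOpen Ω) {p : ℝ} (hp : 0 < p)
    {i : Fin N} {u g : EuclideanSpace ℝ (Fin N) → ℝ} (h : HasWeakPartial Ω i u g) :
    eLpNorm g (ENNReal.ofReal p) (volume.restrict Ω) ≤ sobolevNormPow Ω p u ^ p⁻¹ := by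
  rw [← eLpNorm_congr_ae (h.weakPartial_ae_eq hΩ), ENNReal.le_rpow_inv_iff hp]
  exact (Finset.single_le_sum (f := fun i => eLpNorm (weakPartial Ω i u) (ENNReal.ofReal p)
    (volume.restrict Ω) ^ p) (fun _ _ => zero_le) (Finset.mem_univ i)).trans le_add_self

lemma hasSobolevBound_of_hasWeakPartial (hΩ : IsOpen Ω) {p : ℝ} (hp : 0 < p)
    {u : EuclideanSpace ℝ (Fin N) → ℝ} {G : Fin N → EuclideanSpace ℝ (Fin N) → ℝ}
    (hm : AEStronglyMeasurable u (volume.restrict Ω)) (h : ∀ i, HasWeakPartial Ω i u (G i)) :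
    HasSobolevBound Ω p u G (sobolevNormPow Ω p u ^ p⁻¹) :=
  ⟨hm, h, by rw [ENNReal.le_rpow_inv_iff hp]; exact le_self_add,
    fun i => (h i).eLpNorm_le_rpow_sobolevNormPow hΩ hp⟩

/-! ### Cutoff functions -/

/-- Smooth functions `η n ≥ 0` with compact support such that `η n` vanishes on `ball 0 n` and
`∑ n, η n = 1`. -/
lemma exists_cutoff (N : ℕ) : ∃ η : ℕ → EuclideanSpace ℝ (Fin N) → ℝ,
    (∀ n, ContDiff ℝ ∞ (η n)) ∧ (∀ n, HasCompactSupport (η n)) ∧ (∀ n x, 0 ≤ η n x) ∧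
    (∀ n, EqOn (η n) 0 (ball 0 n)) ∧
    ∀ R : ℕ, ∀ x ∈ ball (0 : EuclideanSpace ℝ (Fin N)) R, ∑ n ∈ Finset.range R, η n x = 1 := by
  -- The `η n` are successive differences of the bumps `χ n`. They are nonnegative because `χ k`
  -- vanishes outside the ball of radius `k + 2`, on which `χ (k + 1)` is 1.
  let χ : ℕ → ContDiffBump (0 : EuclideanSpace ℝ (Fin N)) := fun n =>
    ⟨n + 1, n + 2, by positivity, by linarith⟩
  have h1 : ∀ (n : ℕ) x, x ∈ ball (0 : EuclideanSpace ℝ (Fin N)) (n + 1) → χ n x = 1 := fun n x hx =>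
    (χ n).one_of_mem_closedBall (ball_subset_closedBall hx)
  let η : ℕ → EuclideanSpace ℝ (Fin N) → ℝ := fun n =>
    Nat.casesOn n (χ 0) fun k => (χ (k + 1) : EuclideanSpace ℝ (Fin N) → ℝ) - χ k
  have hsum : ∀ R x, ∑ n ∈ Finset.range (R + 1), η n x = χ R x := by
    intro R x
    induction R with
    | zero => simp [η]
    | succ R ih => rw [Finset.sum_range_succ, ih]; simp [η]
  refine ⟨η, fun n => ?_, fun n => ?_, fun n x => ?_, fun n x hx => ?_, fun R x hx => ?_⟩
  · cases n with
    | zero => exact (χ 0).contDiff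
    | succ k => exact (χ (k + 1)).contDiff.sub (χ k).contDiff
  · cases n with
    | zero => exact (χ 0).hasCompactSupport
    | succ k => exact (χ (k + 1)).hasCompactSupport.sub (χ k).hasCompactSupport
  · cases n with
    | zero => exact (χ 0).nonneg
    | succ k =>
      show 0 ≤ χ (k + 1) x - χ k x
      by_cases hx : x ∈ ball (0 : EuclideanSpace ℝ (Fin N)) (k + 2)
      · rw [h1 (k + 1) x (by convert hx using 2; push_cast; ring)]
        linarith [(χ k).le_one (x := x)]
      · have : χ k x = 0 := (χ k).zero_of_le_dist (by simpa [χ] using hx)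
        rw [this, sub_zero]
        exact (χ (k + 1)).nonneg
  · cases n with
    | zero => simp at hx
    | succ k =>
      have hx' : x ∈ ball (0 : EuclideanSpace ℝ (Fin N)) (k + 1) := by simpa using hx
      show χ (k + 1) x - χ k x = 0
      rw [h1 k x hx', h1 (k + 1) x (ball_subset_ball (by simp) hx'), sub_self]
  · cases R with
    | zero => simp at hx
    | succ R =>
      rw [hsum]
      exact h1 R x (by simpa using hx)

lemma mulPartial_eqOn_zero {η : EuclideanSpace ℝ (Fin N) → ℝ} {r : ℝ}
    (h : EqOn η 0 (ball 0 r)) (u : EuclideanSpace ℝ (Fin N) → ℝ)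
    (G : Fin N → EuclideanSpace ℝ (Fin N) → ℝ) (i : Fin N) :
    EqOn (mulPartial η u G i) 0 (ball 0 r) := by
  intro x hx
  have h1 : η =ᶠ[𝓝 x] 0 := h.eventuallyEq_of_mem (isOpen_ball.mem_nhds hx)
  simp [mulPartial, h hx, h1.fderiv_eq]

/-! ### Approximation and admissibility of locally finite sums -/

lemma MemW.sub {p : ℝ} {u v : EuclideanSpace ℝ (Fin N) → ℝ} (hu : MemW Ω p u)
    (hv : MemW Ω p v) : MemW Ω p (u - v) := by
  refine ⟨hu.1.sub hv.1, fun i => ?_⟩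
  obtain ⟨g, hg, hg'⟩ := hu.2 i
  obtain ⟨k, hk, hk'⟩ := hv.2 i
  exact ⟨g - k, hg.sub hk, hg'.sub hk'⟩

lemma memCc_sum_mul {η v : ℕ → EuclideanSpace ℝ (Fin N) → ℝ} (hη : ∀ n, Continuous (η n))
    (hv : ∀ n, MemCc Ω (v n)) (s : Finset ℕ) : MemCc Ω (∑ n ∈ s, η n * v n) := by
  classical
  induction s using Finset.induction_on with
  | empty => exact ⟨continuous_zero, HasCompactSupport.zero⟩
  | insert a s ha ih =>
    rw [Finset.sum_insert ha]
    exact ⟨(((hη a).comp continuous_subtype_val).mul (hv a).1).add ih.1,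
      ((hv a).2.mul_left (f := (closure Ω).domRestrict (η a))).add ih.2⟩

lemma exists_hasSobolevBound_of_relCap_eq_zero (hΩ : IsOpen Ω) {p : ℝ} (hp : 0 < p)
    {A : Set (EuclideanSpace ℝ (Fin N))} (h : relCap Ω p A = 0) {δ : ℝ≥0∞} (hδ : δ ≠ 0) :
    ∃ u ∈ admissible Ω p A, ∃ G, HasSobolevBound Ω p u G δ := by
  have hpos : relCap Ω p A < δ ^ p := h ▸ ENNReal.rpow_pos_of_nonneg hδ.bot_lt hp.le
  simp only [relCap, iInf_lt_iff] at hpos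
  obtain ⟨u, hu, hlt⟩ := hpos
  choose G hG using hu.1.1.2
  exact ⟨u, hu, G, (hasSobolevBound_of_hasWeakPartial hΩ hp hu.1.1.1.1 fun i => (hG i).1).mono
    ((ENNReal.rpow_inv_le_iff hp).2 hlt.le)⟩

lemma MemWTilde.exists_hasSobolevBound_sub (hΩ : IsOpen Ω) {p : ℝ} (hp : 0 < p)
    {u : EuclideanSpace ℝ (Fin N) → ℝ} (hu : MemWTilde Ω p u) {δ : ℝ≥0∞} (hδ : δ ≠ 0) :
    ∃ v, MemCc Ω v ∧ ∃ G, HasSobolevBound Ω p (u - v) G δ := by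
  obtain ⟨v, hv, hc, hlt⟩ := hu.2 (δ ^ p) (ENNReal.rpow_pos_of_nonneg hδ.bot_lt hp.le)
  have huv := hu.1.sub hv
  choose G hG using huv.2
  exact ⟨v, hc, G, (hasSobolevBound_of_hasWeakPartial hΩ hp huv.1.1 fun i => (hG i).1).mono
    ((ENNReal.rpow_inv_le_iff hp).2 hlt.le)⟩

lemma exists_mul_rpow_lt {q : ℝ} (hq : 0 < q) (N : ℕ) {ε : ℝ≥0∞} (hε : 0 < ε) :
    ∃ δ : ℝ≥0∞, 0 < δ ∧ (N + 1) * δ ^ q < ε := by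
  have h : Tendsto (fun δ : ℝ≥0∞ => (N + 1) * δ ^ q) (𝓝[>] 0) (𝓝 0) := by
    have h1 : Tendsto (fun δ : ℝ≥0∞ => δ ^ q) (𝓝 0) (𝓝 0) := by
      simpa [ENNReal.zero_rpow_of_pos hq] using
        (ENNReal.continuous_rpow_const (y := q)).tendsto (0 : ℝ≥0∞)
    have h2 := ENNReal.Tendsto.const_mul (a := (N + 1 : ℝ≥0∞)) h1 (Or.inr (by finiteness))
    simpa using h2.mono_left nhdsWithin_le_nhds
  obtain ⟨δ, h1, h2⟩ := ((h.eventually (gt_mem_nhds hε)).and self_mem_nhdsWithin).exists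
  exact ⟨δ, h2, h1⟩

lemma mem_ball_zero_of_le {x : EuclideanSpace ℝ (Fin N)} {m n : ℕ} (hmn : m ≤ n)
    (hx : x ∈ ball 0 (m : ℝ)) : x ∈ ball 0 (n : ℝ) :=
  ball_subset_ball (by exact_mod_cast hmn) hx

/-- A locally finite sum of cut-off functions of `W̃^{1,p}` with summable bounds lies in
`W̃^{1,q}`. -/
lemma memWTilde_tsum_mul (hΩ : IsOpen Ω) {p q : ℝ} (hq : 1 < q) (hqp : q ≤ p)
    {η u : ℕ → EuclideanSpace ℝ (Fin N) → ℝ} (hη : ∀ n, ContDiff ℝ ∞ (η n))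
    (hc : ∀ n, HasCompactSupport (η n)) (hz : ∀ n, EqOn (η n) 0 (ball 0 n))
    (hu : ∀ n, MemWTilde Ω p (u n)) {G : ℕ → Fin N → EuclideanSpace ℝ (Fin N) → ℝ}
    {δ : ℕ → ℝ≥0∞} (hδ : ∑' n, δ n ≠ ⊤)
    (hb : ∀ n, HasSobolevBound Ω q (η n * u n) (mulPartial (η n) (u n) (G n)) (δ n)) :
    MemWTilde Ω q (fun x => ∑' n, (η n * u n) x) := by
  have hp : 0 < p := by linarith
  have hzmul : ∀ (w : ℕ → EuclideanSpace ℝ (Fin N) → ℝ) n, EqOn (η n * w n) 0 (ball 0 n) :=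
    fun w n x hx => by simp [hz n hx]
  have hW : MemW Ω q (fun x => ∑' n, (η n * u n) x) :=
    (HasSobolevBound.tsum hq.le hb (hzmul u)
      fun n => mulPartial_eqOn_zero (hz n) (u n) (G n)).memW hδ
  refine ⟨hW, fun ε hε => ?_⟩
  obtain ⟨γ, hγ, hγε⟩ := exists_mul_rpow_lt (by linarith : 0 < q) N hε
  -- One half pays for the approximations, the other for the tail. The cap at 1 keeps the bound
  -- finite, since `γ` may be `⊤`.
  have hhalf : min γ 1 / 2 ≠ 0 := by simp [hγ.ne']
  obtain ⟨ε', hε', hε'sum⟩ := ENNReal.exists_pos_sum_of_countable' hhalf ℕ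
  obtain ⟨K, hK⟩ := ((ENNReal.tendsto_sum_nat_add δ hδ).eventually
    (gt_mem_nhds hhalf.bot_lt)).exists
  choose C hC hCb using fun n => exists_hasSobolevBound_mul hΩ hq.le hqp (hη n) (hc n)
  choose v hv H hH using fun n =>
    (hu n).exists_hasSobolevBound_sub hΩ hp (δ := ε' n / C n)
      (ENNReal.div_ne_zero.2 ⟨(hε' n).ne', hC n⟩)
  let V := ∑ n ∈ Finset.range K, η n * v n
  -- Chosen so that the error `∑ η n * u n - V` is itself a locally finite sum `∑ η n * w n`.
  let w : ℕ → EuclideanSpace ℝ (Fin N) → ℝ := fun n => if n < K then u n - v n else u n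
  let F : ℕ → Fin N → EuclideanSpace ℝ (Fin N) → ℝ := fun n => if n < K then H n else G n
  let b : ℕ → ℝ≥0∞ := fun n => if n < K then ε' n else δ n
  have hwb : ∀ n, HasSobolevBound Ω q (η n * w n) (mulPartial (η n) (w n) (F n)) (b n) := by
    intro n
    by_cases hn : n < K
    · simp only [w, F, b, if_pos hn]
      exact (hCb n _ _ _ (hH n)).mono ENNReal.mul_div_le
    · simpa only [w, F, b, if_neg hn] using hb n
  have hbsum : ∑' n, b n ≤ min γ 1 := by
    rw [← ENNReal.summable.sum_add_tsum_nat_add' (f := b) (k := K)]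
    have h1 : ∑ n ∈ Finset.range K, b n ≤ min γ 1 / 2 := by
      refine le_trans ?_ ((ENNReal.sum_le_tsum (Finset.range K)).trans hε'sum.le)
      exact Finset.sum_le_sum fun n hn => by simp [b, Finset.mem_range.1 hn]
    have h2 : ∑' n, b (n + K) ≤ min γ 1 / 2 := by simpa [b] using hK.le
    exact (add_le_add h1 h2).trans_eq (ENNReal.add_halves _)
  have hdiff : (fun x => ∑' n, (η n * u n) x) - V = fun x => ∑' n, (η n * w n) x := by
    ext x
    obtain ⟨R₀, hR₀⟩ := exists_nat_gt ‖x‖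
    -- The range up to `max R₀ K` contains both the terms nonzero at `x` and all terms of `V`.
    have hx : x ∈ ball (0 : EuclideanSpace ℝ (Fin N)) (max R₀ K : ℕ) :=
      mem_ball_zero_of_le (le_max_left R₀ K) (by simpa using hR₀)
    have hfin : ∀ f : ℕ → EuclideanSpace ℝ (Fin N) → ℝ,
        ∑' n, (η n * f n) x = ∑ n ∈ Finset.range (max R₀ K), (η n * f n) x := fun f =>
      tsum_eq_sum fun n hn => hzmul f n (mem_ball_zero_of_le (by simpa using hn) hx)
    have hV : V x = ∑ n ∈ Finset.range (max R₀ K), if n < K then (η n * v n) x else 0 := by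
      rw [← Finset.sum_filter]
      simp only [V, Finset.sum_apply]
      congr 1
      ext n
      simp only [Finset.mem_filter, Finset.mem_range, lt_max_iff]
      tauto
    rw [Pi.sub_apply, hfin, hfin, hV, ← Finset.sum_sub_distrib]
    refine Finset.sum_congr rfl fun n _ => ?_
    by_cases hn : n < K
    · simp [w, hn, mul_sub]
    · simp [w, hn]
  have hbound : HasSobolevBound Ω q ((fun x => ∑' n, (η n * u n) x) - V) _ (∑' n, b n) :=
    hdiff ▸ HasSobolevBound.tsum hq.le hwb (hzmul w)
      fun n => mulPartial_eqOn_zero (hz n) (w n) (F n)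
  refine ⟨V, ?_, memCc_sum_mul (fun n => (hη n).continuous) hv _, ?_⟩
  -- `V` is the full sum minus the error, both in `W^{1,q}`.
  · simpa using hW.sub (hbound.memW (hbsum.trans_lt (by simp)).ne)
  · refine (hbound.sobolevNormPow_le hΩ (by linarith)).trans_lt (lt_of_le_of_lt ?_ hγε)
    gcongr
    exact hbsum.trans (min_le_left _ _)

/-- A set of vanishing relative `p`-capacity has admissible functions of arbitrarily small norm in
`W^{1,q}`, for `q ≤ p`. -/
lemma exists_admissible_hasSobolevBound (hΩ : IsOpen Ω) {p q : ℝ} (hq : 1 < q) (hqp : q ≤ p)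
    {A : Set (EuclideanSpace ℝ (Fin N))} (hA : A ⊆ closure Ω) (h : relCap Ω p A = 0)
    {δ : ℝ≥0∞} (hδ : δ ≠ 0) :
    ∃ u ∈ admissible Ω q A, ∃ G, HasSobolevBound Ω q u G δ := by
  have hp : 0 < p := by linarith
  obtain ⟨η, hη, hc, hpos, hz, hone⟩ := exists_cutoff N
  choose C hC hCb using fun n => exists_hasSobolevBound_mul hΩ hq.le hqp (hη n) (hc n)
  obtain ⟨δ', hδ', hδ'sum⟩ := ENNReal.exists_pos_sum_of_countable' hδ ℕ
  -- If `C n = 0` the quotient is `⊤`, which is harmless: `C n * (δ' n / C n) ≤ δ' n` still holds.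
  choose u hu G hG using fun n => exists_hasSobolevBound_of_relCap_eq_zero hΩ hp h
    (δ := δ' n / C n) (ENNReal.div_ne_zero.2 ⟨(hδ' n).ne', hC n⟩)
  have hb : ∀ n, HasSobolevBound Ω q (η n * u n) (mulPartial (η n) (u n) (G n)) (δ' n) :=
    fun n => (hCb n _ _ _ (hG n)).mono ENNReal.mul_div_le
  refine ⟨fun x => ∑' n, (η n * u n) x, ⟨memWTilde_tsum_mul hΩ hq hqp hη hc hz
    (fun n => (hu n).1) hδ'sum.ne_top hb, ?_⟩, _, (HasSobolevBound.tsum hq.le hb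
    (fun n x hx => by simp [hz n hx]) fun n =>
      mulPartial_eqOn_zero (hz n) (u n) (G n)).mono hδ'sum.le⟩
  choose O hO hAO hle using fun n => (hu n).2
  choose U hUopen hU using hO
  -- A plain intersection of all `U n` need not be open; inside `ball 0 R` only `n < R` matter.
  let W : Set (EuclideanSpace ℝ (Fin N)) := ⋃ R : ℕ, ball 0 R ∩ ⋂ n ∈ Finset.range R, U n
  refine ⟨W ∩ closure Ω, ⟨W, isOpen_iUnion fun R =>
    isOpen_ball.inter (isOpen_biInter_finset fun n _ => hUopen n), rfl⟩, fun x hx => ?_, ?_⟩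
  · obtain ⟨R, hR⟩ := exists_nat_gt ‖x‖
    exact ⟨mem_iUnion.2 ⟨R, by simpa using hR, mem_iInter₂.2 fun n _ =>
      ((hU n) ▸ hAO n hx : x ∈ U n ∩ closure Ω).1⟩, hA hx⟩
  · have hmeas : ∀ {S : Set (EuclideanSpace ℝ (Fin N))}, IsOpen S →
        MeasurableSet (S ∩ closure Ω ∩ Ω) := fun hS =>
      (hS.measurableSet.inter isClosed_closure.measurableSet).inter hΩ.measurableSet
    have hall : ∀ᵐ x ∂volume, ∀ n, x ∈ U n ∩ closure Ω ∩ Ω → 1 ≤ u n x :=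
      ae_all_iff.2 fun n => (ae_restrict_iff' (hmeas (hUopen n))).1 (hU n ▸ hle n)
    rw [ae_restrict_iff' (hmeas (isOpen_iUnion fun R =>
      isOpen_ball.inter (isOpen_biInter_finset fun n _ => hUopen n)))]
    filter_upwards [hall] with x hx hxW
    obtain ⟨R, hxR, hxU⟩ := mem_iUnion.1 hxW.1.1
    rw [tsum_eq_sum (s := Finset.range R) fun n hn => by
      simp [hz n (mem_ball_zero_of_le (by simpa using hn) hxR)], ← hone R x hxR]
    refine Finset.sum_le_sum fun n hn => ?_
    exact le_mul_of_one_le_right (hpos n x)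
      (hx n ⟨⟨mem_iInter₂.1 hxU n hn, hxW.1.2⟩, hxW.2⟩)

end RelativeCapacity

theorem mainTheorem12 {N : ℕ} (Ω : Set (EuclideanSpace ℝ (Fin N))) (hΩ : IsOpen Ω)
    (hne : Ω.Nonempty) (p q : ℝ) (hq : 1 < q) (hqp : q ≤ p)
    (A : Set (EuclideanSpace ℝ (Fin N))) (hA : A ⊆ closure Ω)
    (h : RelativeCapacity.relCap Ω p A = 0) : RelativeCapacity.relCap Ω q A = 0 := by
  refine le_antisymm (le_of_forall_gt fun ε hε => ?_) zero_le
  obtain ⟨δ, hδ, hδε⟩ := RelativeCapacity.exists_mul_rpow_lt (by linarith : 0 < q) N hε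
  obtain ⟨u, hu, G, hG⟩ :=
    RelativeCapacity.exists_admissible_hasSobolevBound hΩ hq hqp hA h hδ.ne'
  exact (iInf₂_le u hu).trans_lt
    ((hG.sobolevNormPow_le hΩ (by linarith)).trans_lt hδε)
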